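/- **Setting.** Consider a unitary rational conformal model with a finite set $I$ of primary fields, vacuum $0\in I$, fusion multiplicities $N_{pq}^{r}\in\mathbb{Z}_{\ge 0}$ and modular matrix $S$: $S$ is a symmetric unitary complex matrix indexed by $I$, $S_{0p}$ is real and positive for all $p$, and Verlinde's formula $N_{pq}^{r}=\sum_{s}S_{ps}S_{qs}\overline{S_{rs}}/S_{0s}$ holds. (Only these data enter.) Put $\rho_p(\alpha)=S_{\alpha p}/S_{0p}$, the irreducible representation of the fusion algebra attached to $p$, and let $\mathtt{d}_p=S_{0p}/S_{00}$ be the quantum dimension of $p$. The *deconstruction lattice* $\mathscr{L}$ is the set of all subsets $\mathfrak{g}\subseteq I$ that contain $0$ and are closed under fusion ($p,q\in\mathfrak{g}$ and $N_{pq}^{r}>0$ imply $r\in\mathfrak{g}$), ordered by inclusion; its meet is intersection, and $\mathfrak{g}\vee\mathfrak{h}$ is the least element of $\mathscr{L}$ containing both $\mathfrak{g}$ and $\mathfrak{h}$. For $\mathfrak{g}\in\mathscr{L}$ the *$\mathfrak{g}$-classes* are the classes of the equivalence relation $p\sim q\iff\rho_p|_{\mathfrak{g}}=\rho_q|_{\mathfrak{g}}$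 on $I$; the *trivial class* $\mathfrak{g}^{\perp}\in\mathscr{L}$ is the one containing $0$, and $\mathfrak{g}\mapsto\mathfrak{g}^{\perp}$ is an involution of $\mathscr{L}$. The *mass* of a $\mathfrak{g}$-class $C$ is $\sum_{p\in C}\mathtt{d}_p^{2}$, and $C$ is *central* if its mass is minimal among all $\mathfrak{g}$-classes. The central $\mathfrak{g}$-classes form an abelian group $\mathtt{Z}(\mathfrak{g})$ with identity $\mathfrak{g}^{\perp}$, in which the product of $\mathtt{z},\mathtt{w}$ is the central class whose central character is $\varpi_{\mathtt{z}}\varpi_{\mathtt{w}}$, where $\varpi_{\mathtt{z}}(\alpha)=\rho_p(\alpha)/\mathtt{d}_\alpha$ for $\alpha\in\mathfrak{g}$ and any $p\in\mathtt{z}$. For a subgroup $H<\mathtt{Z}(\mathfrak{g})$ the *central quotient* $\mathfrak{g}/H$ is the element of $\mathscr{L}$ determined by $(\mathfrak{g}/H)^{\perp}=\bigcup_{\mathtt{z}\in H}\mathtt{z}$, and $\boldsymbol{\partial}\mathfrak{g}=\mathfrak{g}/\mathtt{Z}(\mathfrak{g})$ is the *maximal central quotient*. For $\mathfrak{h}\subseteq\mathfrak{g}$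 in $\mathscr{L}$, let $\mathtt{Z}(\mathfrak{g}|\mathfrak{h})<\mathtt{Z}(\mathfrak{g})$ and $\mathtt{I}(\mathfrak{g}|\mathfrak{h})<\mathtt{Z}(\mathfrak{h})$ be the kernel and the image of the restriction homomorphism $\mathtt{Z}(\mathfrak{g})\to\mathtt{Z}(\mathfrak{h})$ that sends a central $\mathfrak{g}$-class to the $\mathfrak{h}$-class containing it. **Theorem.** For all $\mathfrak{g},\mathfrak{h}\in\mathscr{L}$ with $\mathfrak{h}\subseteq\mathfrak{g}$, $$\mathfrak{g}/\mathtt{Z}(\mathfrak{g}|\mathfrak{h})=\mathfrak{h}\vee\boldsymbol{\partial}\mathfrak{g}\qquad\text{and}\qquad \mathfrak{h}/\mathtt{I}(\mathfrak{g}|\mathfrak{h})=\mathfrak{h}\cap\boldsymbol{\partial}\mathfrak{g},$$ and in particular $\mathtt{I}(\mathfrak{g}|\mathfrak{h})=\mathtt{Z}(\mathfrak{h}\,|\,\mathfrak{h}\cap\boldsymbol{\partial}\mathfrak{g})$ as subgroups of $\mathtt{Z}(\mathfrak{h})$. -/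

import Mathlib

open scoped ComplexConjugate

/-- The fusion-theoretic data of a unitary rational conformal model with a finite set `I` of primary
fields: a vacuum, fusion multiplicities, and a symmetric unitary modular matrix `S` with positive
vacuum row, related to each other by Verlinde's formula. -/
structure ConformalModel (I : Type*) [Fintype I] [DecidableEq I] where
  /-- the vacuum primary -/
  vac : I
  /-- `N p q r` is the multiplicity of `r` in the fusion product of `p` and `q` -/
  N : I → I → I → ℕ
  /-- matrix of the modular transformation `τ ↦ -1/τ` on the chiral characters -/
  S : Matrix I I ℂ
  S_unitary : S ∈ Matrix.unitaryGroup I ℂ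
  S_symm : ∀ p q, S p q = S q p
  S_vac_im : ∀ p, (S vac p).im = 0
  S_vac_pos : ∀ p, 0 < (S vac p).re
  verlinde : ∀ p q r, (N p q r : ℂ) = ∑ s, S p s * S q s * conj (S r s) / S vac s

namespace ConformalModel

variable {I : Type*} [Fintype I] [DecidableEq I] (M : ConformalModel I)

/-- The irreducible representation `ρ_p` of the fusion algebra attached to the primary `p`,
evaluated at the primary `α`. -/
noncomputable def rho (p α : I) : ℂ := M.S α p / M.S M.vac p

/-- Quantum dimension of a primary. -/
noncomputable def qdim (p : I) : ℝ := (M.S M.vac p).re / (M.S M.vac M.vac).re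

/-! ### Basic facts about the fusion algebra -/

theorem S_vac_eq (p : I) : M.S M.vac p = ((M.S M.vac p).re : ℂ) := by
  apply Complex.ext <;> simp [M.S_vac_im p]

theorem S_vac_ne (p : I) : M.S M.vac p ≠ 0 := by
  intro h
  have := M.S_vac_pos p
  rw [h] at this
  simp at this

theorem conj_S_vac (p : I) : conj (M.S M.vac p) = M.S M.vac p := by
  rw [M.S_vac_eq p, Complex.conj_ofReal]

theorem qdim_pos (p : I) : 0 < M.qdim p := div_pos (M.S_vac_pos p) (M.S_vac_pos _)

theorem rho_vac_left (α : I) : M.rho M.vac α = (M.qdim α : ℂ) := by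
  unfold rho qdim
  rw [M.S_symm α M.vac, M.S_vac_eq α, M.S_vac_eq M.vac]
  push_cast
  simp

theorem rho_vac (p : I) : M.rho p M.vac = 1 := div_self (M.S_vac_ne p)

theorem qdim_vac : M.qdim M.vac = 1 := div_self (M.S_vac_pos _).ne'

theorem rho_symm (p α : I) : M.rho p α * (M.qdim p : ℂ) = M.rho α p * (M.qdim α : ℂ) := by
  have h := M.S_vac_ne
  rw [← M.rho_vac_left, ← M.rho_vac_left]
  unfold rho
  rw [M.S_symm p M.vac, M.S_symm α M.vac, M.S_symm p α]
  have h1 := h p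
  have h2 := h α
  have h3 := h M.vac
  field_simp

theorem S_orth (s t : I) : ∑ α, conj (M.S α s) * M.S α t = if s = t then 1 else 0 := by
  have h := Matrix.mem_unitaryGroup_iff'.1 M.S_unitary
  have h2 := congrFun (congrFun h s) t
  simpa [Matrix.mul_apply, Matrix.one_apply] using h2

theorem rho_mul (p α β : I) :
    M.rho p α * M.rho p β = ∑ γ, (M.N α β γ : ℂ) * M.rho p γ := by
  have key : ∑ γ, (M.N α β γ : ℂ) * M.S γ p = M.S α p * M.S β p / M.S M.vac p := by
    simp_rw [M.verlinde, Finset.sum_mul]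
    rw [Finset.sum_comm]
    have : ∀ s, ∑ γ, M.S α s * M.S β s * conj (M.S γ s) / M.S M.vac s * M.S γ p
        = M.S α s * M.S β s / M.S M.vac s * (if s = p then 1 else 0) := by
      intro s
      rw [← M.S_orth s p, Finset.mul_sum]
      refine Finset.sum_congr rfl fun γ _ => ?_
      ring
    simp_rw [this]
    simp
  have h := M.S_vac_ne p
  unfold rho
  simp_rw [← mul_div_assoc]
  rw [← Finset.sum_div, key]
  field_simp

theorem rho_conj_sum (p α γ : I) :
    ∑ β, (M.N α β γ : ℂ) * conj (M.rho p β) = M.rho p α * conj (M.rho p γ) := by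
  have key : ∑ β, (M.N α β γ : ℂ) * conj (M.S β p)
      = M.S α p * conj (M.S γ p) / M.S M.vac p := by
    simp_rw [M.verlinde, Finset.sum_mul]
    rw [Finset.sum_comm]
    have : ∀ s, ∑ β, M.S α s * M.S β s * conj (M.S γ s) / M.S M.vac s * conj (M.S β p)
        = M.S α s * conj (M.S γ s) / M.S M.vac s * (if p = s then 1 else 0) := by
      intro s
      rw [← M.S_orth p s, Finset.mul_sum]
      refine Finset.sum_congr rfl fun γ _ => ?_
      ring
    simp_rw [this]
    simp
  have h := M.S_vac_ne p
  unfold rho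
  simp_rw [map_div₀, M.conj_S_vac, ← mul_div_assoc]
  rw [← Finset.sum_div, key]
  field_simp

theorem qdim_mul (α β : I) :
    M.qdim α * M.qdim β = ∑ γ, (M.N α β γ : ℝ) * M.qdim γ := by
  have h := M.rho_mul M.vac α β
  simp_rw [M.rho_vac_left] at h
  exact_mod_cast h

theorem qdim_conj_sum (α γ : I) :
    ∑ β, (M.N α β γ : ℝ) * M.qdim β = M.qdim α * M.qdim γ := by
  have h := M.rho_conj_sum M.vac α γ
  simp_rw [M.rho_vac_left, Complex.conj_ofReal] at h
  exact_mod_cast h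

theorem norm_rho_le (p α : I) : ‖M.rho p α‖ ≤ M.qdim α := by
  obtain ⟨β, -, hβ⟩ := Finset.exists_max_image Finset.univ
    (fun β => ‖M.rho p β‖ / M.qdim β) ⟨M.vac, Finset.mem_univ _⟩
  set m := ‖M.rho p β‖ / M.qdim β with hm
  have hmpos : 0 < m := by
    have h := hβ M.vac (Finset.mem_univ _)
    simp only [M.rho_vac, M.qdim_vac, norm_one, div_one] at h
    linarith
  have hle : ∀ γ, ‖M.rho p γ‖ ≤ m * M.qdim γ := fun γ =>
    (div_le_iff₀ (M.qdim_pos γ)).1 (hβ γ (Finset.mem_univ _))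
  have hb : ‖M.rho p β‖ = m * M.qdim β := by
    rw [hm, div_mul_cancel₀ _ (M.qdim_pos β).ne']
  have h1 : ‖M.rho p α‖ * (m * M.qdim β) ≤ M.qdim α * (m * M.qdim β) := by
    calc ‖M.rho p α‖ * (m * M.qdim β) = ‖M.rho p α * M.rho p β‖ := by rw [norm_mul, hb]
      _ = ‖∑ γ, (M.N α β γ : ℂ) * M.rho p γ‖ := by rw [M.rho_mul]
      _ ≤ ∑ γ, ‖(M.N α β γ : ℂ) * M.rho p γ‖ := norm_sum_le _ _
      _ ≤ ∑ γ, (M.N α β γ : ℝ) * (m * M.qdim γ) := by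
          refine Finset.sum_le_sum fun γ _ => ?_
          rw [norm_mul, Complex.norm_natCast]
          exact mul_le_mul_of_nonneg_left (hle γ) (Nat.cast_nonneg _)
      _ = m * ∑ γ, (M.N α β γ : ℝ) * M.qdim γ := by
          rw [Finset.mul_sum]
          exact Finset.sum_congr rfl fun γ _ => by ring
      _ = M.qdim α * (m * M.qdim β) := by rw [← M.qdim_mul]; ring
  exact le_of_mul_le_mul_right h1 (mul_pos hmpos (M.qdim_pos β))

/-- Equality case of the triangle inequality. -/
theorem eq_of_sum_eq {J : Type*} [Fintype J] {n b : J → ℝ} {z : J → ℂ} {u : ℂ} (hn : ∀ i, 0 ≤ n i)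
    (hz : ∀ i, ‖z i‖ ≤ b i) (hu : ‖u‖ = 1)
    (h : ∑ i, (n i : ℂ) * z i = u * ((∑ i, n i * b i : ℝ) : ℂ)) {i : J} (hi : 0 < n i) :
    z i = u * (b i : ℂ) := by
  have huu : conj u * u = 1 := by
    rw [mul_comm, Complex.mul_conj, Complex.normSq_eq_norm_sq, hu]; simp
  have h1 : ∑ i, (n i : ℂ) * (conj u * z i) = ((∑ i, n i * b i : ℝ) : ℂ) := by
    calc ∑ i, (n i : ℂ) * (conj u * z i) = conj u * ∑ i, (n i : ℂ) * z i := by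
          rw [Finset.mul_sum]; exact Finset.sum_congr rfl fun i _ => by ring
      _ = conj u * u * ((∑ i, n i * b i : ℝ) : ℂ) := by rw [h]; ring
      _ = _ := by rw [huu, one_mul]
  have h2 : ∑ i, n i * (conj u * z i).re = ∑ i, n i * b i := by
    have := congrArg Complex.re h1
    rw [Complex.re_sum, Complex.ofReal_re] at this
    rw [← this]
    exact Finset.sum_congr rfl fun i _ => (Complex.re_ofReal_mul _ _).symm
  have hnorm : ∀ i, ‖conj u * z i‖ ≤ b i := fun i => by
    rw [norm_mul, RCLike.norm_conj, hu, one_mul]; exact hz i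
  have hre : ∀ i, (conj u * z i).re ≤ b i := fun i => (Complex.re_le_norm _).trans (hnorm i)
  have h3 := (Finset.sum_eq_sum_iff_of_le
    (fun i _ => mul_le_mul_of_nonneg_left (hre i) (hn i))).1 h2 i (Finset.mem_univ _)
  have h4 : (conj u * z i).re = b i := mul_left_cancel₀ hi.ne' h3
  have h5 : (conj u * z i) = (b i : ℂ) := by
    have h6 : (conj u * z i).re = ‖conj u * z i‖ :=
      le_antisymm (Complex.re_le_norm _) (h4 ▸ hnorm i)
    rw [← h4]
    apply Complex.ext
    · simp
    · rw [Complex.ofReal_im]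
      exact (Complex.abs_re_eq_norm.1 (by rw [h6, abs_of_nonneg (norm_nonneg _)]))
  rw [← h5, ← mul_assoc, mul_comm u, huu, one_mul]

/-- If `p` and `q` act on `α` by the scalars `u · d_α` and `v · d_α` of maximal modulus, then every
`r` in the fusion product of `p` and `q` acts on `α` by `u v · d_α`. -/
theorem rho_fusion {p q r α : I} {u v : ℂ} (hu : ‖u‖ = 1) (hv : ‖v‖ = 1)
    (hp : M.rho p α = u * (M.qdim α : ℂ)) (hq : M.rho q α = v * (M.qdim α : ℂ))
    (hN : 0 < M.N p q r) : M.rho r α = u * v * (M.qdim α : ℂ) := by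
  have hα : (M.qdim α : ℂ) ≠ 0 := by exact_mod_cast (M.qdim_pos α).ne'
  have sw : ∀ s w, M.rho s α = w * (M.qdim α : ℂ) ↔ M.rho α s = w * (M.qdim s : ℂ) := by
    intro s w
    have hs : (M.qdim s : ℂ) ≠ 0 := by exact_mod_cast (M.qdim_pos s).ne'
    have h := M.rho_symm s α
    constructor
    · intro h1
      rw [h1] at h
      apply mul_right_cancel₀ hα
      rw [← h]; ring
    · intro h1
      rw [h1] at h
      apply mul_right_cancel₀ hs
      rw [h]; ring
  rw [sw] at hp hq ⊢
  refine eq_of_sum_eq (n := fun r => (M.N p q r : ℝ)) (b := M.qdim) (fun _ => Nat.cast_nonneg _)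
    (M.norm_rho_le α) (by rw [norm_mul, hu, hv, one_mul]) ?_ (by exact_mod_cast hN)
  have h := M.rho_mul α p q
  rw [hp, hq] at h
  rw [← M.qdim_mul]
  push_cast
  rw [← h]; ring

theorem exists_fusion (p q : I) : ∃ r, 0 < M.N p q r := by
  by_contra! hcon
  have h := M.qdim_mul p q
  have h0 : ∀ r, M.N p q r = 0 := fun r => Nat.le_zero.1 (hcon r)
  simp only [h0, Nat.cast_zero, zero_mul, Finset.sum_const_zero] at h
  exact (mul_pos (M.qdim_pos p) (M.qdim_pos q)).ne' h

/-- If `p` acts on `α` by the scalar `u · d_α` of maximal modulus, then its charge conjugate acts by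
the complex conjugate scalar. -/
theorem rho_conjugate {p q α : I} {u : ℂ} (hu : ‖u‖ = 1)
    (hp : M.rho p α = u * (M.qdim α : ℂ)) (hN : 0 < M.N p q M.vac) :
    M.rho q α = conj u * (M.qdim α : ℂ) := by
  have hα : (M.qdim α : ℂ) ≠ 0 := by exact_mod_cast (M.qdim_pos α).ne'
  have hp0 : (M.qdim p : ℂ) ≠ 0 := by exact_mod_cast (M.qdim_pos p).ne'
  have hq0 : (M.qdim q : ℂ) ≠ 0 := by exact_mod_cast (M.qdim_pos q).ne'
  have hp1 : M.rho α p = u * (M.qdim p : ℂ) := by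
    have h := M.rho_symm p α
    rw [hp] at h
    apply mul_right_cancel₀ hα
    rw [← h]; ring
  have h1 : conj (M.rho α q) = u * (M.qdim q : ℂ) := by
    refine eq_of_sum_eq (n := fun r => (M.N p r M.vac : ℝ)) (b := M.qdim)
      (z := fun r => conj (M.rho α r)) (fun _ => Nat.cast_nonneg _)
      (fun r => by rw [RCLike.norm_conj]; exact M.norm_rho_le α r) hu ?_ (by exact_mod_cast hN)
    have h := M.rho_conj_sum α p M.vac
    rw [hp1, M.rho_vac] at h
    rw [M.qdim_conj_sum, M.qdim_vac]
    simp only [map_one, mul_one] at h ⊢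
    exact_mod_cast h
  have h2 : M.rho α q = conj u * (M.qdim q : ℂ) := by
    have := congrArg conj h1
    simpa using this
  have h := M.rho_symm q α
  rw [h2] at h
  apply mul_right_cancel₀ hq0
  rw [h]; ring

/-! ### The deconstruction lattice -/

/-- An element of the deconstruction lattice: a set of primaries that contains the vacuum and is
closed under the fusion product. -/
@[ext]
structure Lat where
  carrier : Set I
  vac_mem : M.vac ∈ carrier
  fusion_mem : ∀ {p q r : I}, p ∈ carrier → q ∈ carrier → 0 < M.N p q r → r ∈ carrier

namespace Lat

variable {M}

instance : SetLike M.Lat I where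
  coe := Lat.carrier
  coe_injective _ _ h := Lat.ext h

/-- Order by inclusion, meet given by intersection, and join the least element containing both. -/
instance : Lattice M.Lat where
  le g h := ∀ p, p ∈ g → p ∈ h
  le_refl _ _ hp := hp
  le_trans _ _ _ h₁ h₂ p hp := h₂ p (h₁ p hp)
  le_antisymm _ _ h₁ h₂ := SetLike.ext fun p => ⟨h₁ p, h₂ p⟩
  inf g h :=
    { carrier := {p | p ∈ g ∧ p ∈ h}
      vac_mem := ⟨g.vac_mem, h.vac_mem⟩
      fusion_mem := fun hp hq hN => ⟨g.fusion_mem hp.1 hq.1 hN, h.fusion_mem hp.2 hq.2 hN⟩ }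
  inf_le_left _ _ _ hp := hp.1
  inf_le_right _ _ _ hp := hp.2
  le_inf _ _ _ h₁ h₂ p hp := ⟨h₁ p hp, h₂ p hp⟩
  sup g h :=
    { carrier := {p | ∀ k : M.Lat, (∀ q, q ∈ g → q ∈ k) → (∀ q, q ∈ h → q ∈ k) → p ∈ k}
      vac_mem := fun k _ _ => k.vac_mem
      fusion_mem := fun hp hq hN k h₁ h₂ => k.fusion_mem (hp k h₁ h₂) (hq k h₁ h₂) hN }
  le_sup_left _ _ p hp _ h₁ _ := h₁ p hp
  le_sup_right _ _ p hp _ _ h₂ := h₂ p hp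
  sup_le _ _ k h₁ h₂ _ hp := hp k h₁ h₂

/-- An element of the lattice is closed under taking fusion quotients (hence under charge
conjugation). -/
theorem quot_mem (g : M.Lat) {α β γ : I} (hα : α ∈ g) (hγ : γ ∈ g) (hN : 0 < M.N α β γ) :
    β ∈ g := by
  classical
  let s : Finset I := Finset.univ.filter (· ∈ g)
  have hs : ∀ x, x ∈ s ↔ x ∈ g := fun x => by simp [s]
  have hle : ∀ γ, ∑ β ∈ s, (M.N α β γ : ℝ) * M.qdim β ≤ M.qdim α * M.qdim γ := fun γ => by
    rw [← M.qdim_conj_sum]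
    exact Finset.sum_le_univ_sum_of_nonneg
      fun β => mul_nonneg (Nat.cast_nonneg _) (M.qdim_pos β).le
  have htot : ∑ γ ∈ s, M.qdim γ * ∑ β ∈ s, (M.N α β γ : ℝ) * M.qdim β
      = ∑ γ ∈ s, M.qdim γ * (M.qdim α * M.qdim γ) := by
    simp_rw [Finset.mul_sum]
    rw [Finset.sum_comm]
    refine Finset.sum_congr rfl fun β hβ => ?_
    rw [M.qdim_mul, Finset.mul_sum]
    have : ∑ γ ∈ s, M.qdim β * ((M.N α β γ : ℝ) * M.qdim γ)
        = ∑ γ, M.qdim β * ((M.N α β γ : ℝ) * M.qdim γ) := by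
      refine Finset.sum_subset (Finset.subset_univ _) fun γ _ hγ => ?_
      have h0 : M.N α β γ = 0 := by
        by_contra hne
        exact hγ ((hs γ).2 (g.fusion_mem hα ((hs β).1 hβ) (Nat.pos_of_ne_zero hne)))
      simp [h0]
    rw [← this]
    exact Finset.sum_congr rfl fun γ _ => by ring
  have heq := (Finset.sum_eq_sum_iff_of_le (fun γ _ =>
    mul_le_mul_of_nonneg_left (hle γ) (M.qdim_pos γ).le)).1 htot γ ((hs γ).2 hγ)
  have heq' := mul_left_cancel₀ (M.qdim_pos γ).ne' heq
  by_contra hβ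
  have hlt : ∑ β ∈ s, (M.N α β γ : ℝ) * M.qdim β < ∑ β, (M.N α β γ : ℝ) * M.qdim β :=
    Finset.sum_lt_sum_of_subset (Finset.subset_univ s) (Finset.mem_univ β)
      (fun h => hβ ((hs β).1 h)) (mul_pos (by exact_mod_cast hN) (M.qdim_pos β))
      (fun x _ _ => mul_nonneg (Nat.cast_nonneg _) (M.qdim_pos x).le)
  rw [M.qdim_conj_sum, heq'] at hlt
  exact lt_irrefl _ hlt

/-! ### Classes, mass, and the duality map -/

/-- Two primaries are in the same `g`-class if the corresponding irreducible representations of the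
fusion algebra coincide on `g`. -/
def classSetoid (g : M.Lat) : Setoid I where
  r p q := ∀ α ∈ g, M.rho p α = M.rho q α
  iseqv :=
    { refl := fun _ _ _ => rfl
      symm := fun h α hα => (h α hα).symm
      trans := fun h₁ h₂ α hα => (h₁ α hα).trans (h₂ α hα) }

/-- The type of `g`-classes. -/
def Cls (g : M.Lat) : Type _ := Quotient g.classSetoid

/-- The `g`-class of a primary. -/
def cls (g : M.Lat) (p : I) : g.Cls := Quotient.mk g.classSetoid p

theorem cls_eq_iff {g : M.Lat} {p q : I} :
    g.cls p = g.cls q ↔ ∀ α ∈ g, M.rho p α = M.rho q α :=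
  ⟨fun h => Quotient.exact h, fun h => Quotient.sound h⟩

/-- A `g`-class, viewed as a set of primaries. -/
def Cls.toSet {g : M.Lat} (C : g.Cls) : Set I := {p | g.cls p = C}

open Classical in
/-- The mass of a `g`-class. -/
noncomputable def Cls.mass {g : M.Lat} (C : g.Cls) : ℝ :=
  ∑ p with p ∈ C.toSet, M.qdim p ^ 2

/-- The primaries that cannot be distinguished from the vacuum by the elements of the set `X`. -/
def perpSet (M : ConformalModel I) (X : Set I) : M.Lat where
  carrier := {p | ∀ α ∈ X, M.rho p α = M.rho M.vac α}
  vac_mem := fun _ _ => rfl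
  fusion_mem := by
    intro p q r hp hq hN α hα
    have h1 := hp α hα
    have h2 := hq α hα
    rw [M.rho_vac_left] at h1 h2 ⊢
    simpa using M.rho_fusion (u := 1) (v := 1) (by simp) (by simp) (by simpa using h1)
      (by simpa using h2) hN

/-- The trivial class of `g` (the `g`-class of the vacuum), as an element of the lattice. -/
def dual (g : M.Lat) : M.Lat := perpSet M (g : Set I)

theorem coe_dual (g : M.Lat) : (g.dual : Set I) = (g.cls M.vac).toSet := by
  ext p
  exact (cls_eq_iff (g := g) (p := p) (q := M.vac)).symm

/-! ### The center -/

/-- A `g`-class is central if its mass is minimal. -/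
def Cls.IsCentral {g : M.Lat} (C : g.Cls) : Prop := ∀ C' : g.Cls, C.mass ≤ C'.mass

open Classical in
theorem rho_orth (g : M.Lat) (p q : I) :
    ∑ α with α ∈ g, conj (M.rho p α) * M.rho q α
      = if g.cls q = g.cls p then ((∑ α with α ∈ g, ‖M.rho p α‖ ^ 2 : ℝ) : ℂ) else 0 := by
  split_ifs with h
  · rw [cls_eq_iff] at h
    push_cast
    refine Finset.sum_congr rfl fun α hα => ?_
    rw [h α (Finset.mem_filter.1 hα).2, mul_comm, Complex.mul_conj, Complex.normSq_eq_norm_sq]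
    push_cast; rfl
  · rw [cls_eq_iff] at h
    push Not at h
    obtain ⟨β, hβ, hne⟩ := h
    have key : M.rho q β * ∑ α with α ∈ g, conj (M.rho p α) * M.rho q α
        = M.rho p β * ∑ α with α ∈ g, conj (M.rho p α) * M.rho q α := by
      have h1 : ∀ α ∈ Finset.univ.filter (· ∈ g), M.rho q β * (conj (M.rho p α) * M.rho q α)
          = ∑ γ with γ ∈ g, (M.N β α γ : ℂ) * conj (M.rho p α) * M.rho q γ := by
        intro α hα
        have h2 : M.rho q β * M.rho q α = ∑ γ with γ ∈ g, (M.N β α γ : ℂ) * M.rho q γ := by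
          rw [M.rho_mul]
          symm
          refine Finset.sum_subset (Finset.subset_univ _) fun γ _ hγ => ?_
          have h0 : M.N β α γ = 0 := by
            by_contra hne
            exact hγ (Finset.mem_filter.2 ⟨Finset.mem_univ _,
              g.fusion_mem hβ (Finset.mem_filter.1 hα).2 (Nat.pos_of_ne_zero hne)⟩)
          simp [h0]
        calc M.rho q β * (conj (M.rho p α) * M.rho q α)
            = conj (M.rho p α) * (M.rho q β * M.rho q α) := by ring
          _ = _ := by
            rw [h2, Finset.mul_sum]
            exact Finset.sum_congr rfl fun γ _ => by ring
      rw [Finset.mul_sum, Finset.sum_congr rfl h1, Finset.sum_comm, Finset.mul_sum]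
      refine Finset.sum_congr rfl fun γ hγ => ?_
      rw [← Finset.sum_mul, ← mul_assoc, ← M.rho_conj_sum]
      congr 1
      refine Finset.sum_subset (Finset.subset_univ _) fun α _ hα => ?_
      have h0 : M.N β α γ = 0 := by
        by_contra hne
        exact hα (Finset.mem_filter.2 ⟨Finset.mem_univ _,
          g.quot_mem hβ (Finset.mem_filter.1 hγ).2 (Nat.pos_of_ne_zero hne)⟩)
      simp [h0]
    by_contra hX
    exact hne (mul_right_cancel₀ hX key)

theorem sum_S_sq_rho (α : I) :
    ∑ q, M.S M.vac q ^ 2 * M.rho q α = if α = M.vac then 1 else 0 := by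
  have h := M.S_orth M.vac α
  rw [show (if M.vac = α then (1 : ℂ) else 0) = if α = M.vac then 1 else 0 by simp [eq_comm]] at h
  rw [← h]
  refine Finset.sum_congr rfl fun q _ => ?_
  have h0 := M.S_vac_ne q
  rw [M.S_symm q M.vac, M.conj_S_vac, M.S_symm q α]
  unfold rho
  field_simp

open Classical in
/-- The mass of the `g`-class of `p` is inversely proportional to `∑ |ρ_p(α)|²` over `g`. -/
theorem mass_mul (g : M.Lat) (p : I) :
    (g.cls p).mass * ∑ α with α ∈ g, ‖M.rho p α‖ ^ 2 = ((M.S M.vac M.vac).re ^ 2)⁻¹ := by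
  have h1 : ∑ q, M.S M.vac q ^ 2 * ∑ α with α ∈ g, conj (M.rho p α) * M.rho q α = 1 := by
    simp_rw [Finset.mul_sum]
    rw [Finset.sum_comm]
    have : ∀ α, ∑ q, M.S M.vac q ^ 2 * (conj (M.rho p α) * M.rho q α)
        = conj (M.rho p α) * if α = M.vac then 1 else 0 := by
      intro α
      rw [← sum_S_sq_rho, Finset.mul_sum]
      exact Finset.sum_congr rfl fun q _ => by ring
    simp_rw [this]
    rw [Finset.sum_eq_single_of_mem M.vac
      (Finset.mem_filter.2 ⟨Finset.mem_univ _, show M.vac ∈ g from g.vac_mem⟩) (fun b _ hb => by simp [hb])]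
    simp [M.rho_vac]
  simp_rw [rho_orth, mul_ite, mul_zero] at h1
  rw [← Finset.sum_filter, ← Finset.sum_mul] at h1
  have h2 : (∑ q with g.cls q = g.cls p, (M.S M.vac q).re ^ 2)
      * ∑ α with α ∈ g, ‖M.rho p α‖ ^ 2 = 1 := by
    have h3 : ∑ q with g.cls q = g.cls p, M.S M.vac q ^ 2
        = ((∑ q with g.cls q = g.cls p, (M.S M.vac q).re ^ 2 : ℝ) : ℂ) := by
      push_cast
      exact Finset.sum_congr rfl fun q _ => by rw [← M.S_vac_eq q]
    rw [h3] at h1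
    exact_mod_cast h1
  have h4 : (g.cls p).mass
      = (∑ q with g.cls q = g.cls p, (M.S M.vac q).re ^ 2) / (M.S M.vac M.vac).re ^ 2 := by
    unfold Cls.mass qdim Cls.toSet
    rw [Finset.sum_div]
    exact Finset.sum_congr rfl fun q _ => div_pow _ _ _
  rw [h4, div_mul_eq_mul_div, h2, one_div]

open Classical in
theorem sum_norm_pos (g : M.Lat) (p : I) : 0 < ∑ α with α ∈ g, ‖M.rho p α‖ ^ 2 := by
  refine Finset.sum_pos' (fun _ _ => by positivity)
    ⟨M.vac, Finset.mem_filter.2 ⟨Finset.mem_univ _, g.vac_mem⟩, ?_⟩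
  simp [M.rho_vac]

open Classical in
theorem mass_le_mass_iff (g : M.Lat) (p q : I) :
    (g.cls p).mass ≤ (g.cls q).mass ↔
      ∑ α with α ∈ g, ‖M.rho q α‖ ^ 2 ≤ ∑ α with α ∈ g, ‖M.rho p α‖ ^ 2 := by
  have hp := sum_norm_pos g p
  have hq := sum_norm_pos g q
  have h0 : 0 < ((M.S M.vac M.vac).re ^ 2)⁻¹ := by
    have := M.S_vac_pos M.vac
    positivity
  rw [eq_div_of_mul_eq hp.ne' (mass_mul g p), eq_div_of_mul_eq hq.ne' (mass_mul g q)]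
  exact div_le_div_iff_of_pos_left h0 hp hq

/-- The class of `p` is central if and only if `ρ_p` has maximal modulus on `g`. -/
theorem isCentral_iff {g : M.Lat} {p : I} :
    (g.cls p).IsCentral ↔ ∀ α ∈ g, ‖M.rho p α‖ = M.qdim α := by
  classical
  have hsq : ∀ q α, ‖M.rho q α‖ ^ 2 ≤ M.qdim α ^ 2 := fun q α =>
    pow_le_pow_left₀ (norm_nonneg _) (M.norm_rho_le q α) 2
  constructor
  · intro h
    have h1 := (mass_le_mass_iff g p M.vac).1 (h _)
    have hv : ∀ α, ‖M.rho M.vac α‖ ^ 2 = M.qdim α ^ 2 := fun α => by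
      rw [M.rho_vac_left, Complex.norm_real, Real.norm_of_nonneg (M.qdim_pos α).le]
    simp_rw [hv] at h1
    have h2 := (Finset.sum_eq_sum_iff_of_le (fun α _ => hsq p α)).1
      (le_antisymm (Finset.sum_le_sum fun α _ => hsq p α) h1)
    intro α hα
    have h3 := h2 α (Finset.mem_filter.2 ⟨Finset.mem_univ _, hα⟩)
    exact (pow_left_inj₀ (norm_nonneg _) (M.qdim_pos α).le two_ne_zero).1 h3
  · intro h C'
    induction C' using Quotient.inductionOn with
    | h q =>
      refine (mass_le_mass_iff g p q).2 (Finset.sum_le_sum fun α hα => ?_)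
      rw [h α (Finset.mem_filter.1 hα).2]
      exact hsq q α

/-- The center `Z(g)`: the type of central `g`-classes. -/
@[ext]
structure Center (g : M.Lat) where
  toCls : g.Cls
  isCentral : toCls.IsCentral

/-- The central class of a primary `p` on which `g` acts by scalars of maximal modulus. -/
def Center.of {g : M.Lat} (p : I) (hp : (g.cls p).IsCentral) : g.Center := ⟨g.cls p, hp⟩

theorem Center.ind {g : M.Lat} {P : g.Center → Prop}
    (h : ∀ p hp, P (Center.of p hp)) (z : g.Center) : P z := by
  obtain ⟨C, hC⟩ := z
  induction C using Quotient.inductionOn with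
  | h p => exact h p hC

/-- The central character `ϖ_z` of a central class `z`: on `α ∈ g` it is `ρ_p(α) / d_α`, for any
`p ∈ z`. -/
noncomputable def Center.char {g : M.Lat} (z : g.Center) (α : g) : ℂ :=
  Quotient.lift (s := g.classSetoid) (fun p => M.rho p α / (M.qdim α : ℂ))
    (fun _ _ h => by rw [h α α.2]) z.toCls

theorem Center.char_mk {g : M.Lat} (p : I) (hp : (g.cls p).IsCentral) (α : g) :
    (Center.of p hp).char α = M.rho p α / (M.qdim α : ℂ) := rfl

theorem Center.rho_eq {g : M.Lat} {p : I} (hp : (g.cls p).IsCentral) (α : g) :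
    M.rho p α = (Center.of p hp).char α * (M.qdim α : ℂ) := by
  have h : (M.qdim α : ℂ) ≠ 0 := by exact_mod_cast (M.qdim_pos α).ne'
  rw [Center.char_mk, div_mul_cancel₀ _ h]

theorem Center.norm_char {g : M.Lat} (z : g.Center) (α : g) : ‖z.char α‖ = 1 := by
  induction z using Center.ind with
  | h p hp =>
    rw [Center.char_mk, norm_div, isCentral_iff.1 hp α α.2, Complex.norm_real,
      Real.norm_of_nonneg (M.qdim_pos _).le, div_self (M.qdim_pos _).ne']

/-- A central class is determined by its central character. -/
theorem Center.char_injective {g : M.Lat} : Function.Injective (Center.char (g := g)) := by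
  intro z w h
  induction z using Center.ind with
  | h p hp =>
    induction w using Center.ind with
    | h q hq =>
      refine Center.ext (cls_eq_iff.2 fun α hα => ?_)
      rw [Center.rho_eq hp ⟨α, hα⟩, Center.rho_eq hq ⟨α, hα⟩, h]

/-- Fusion of primaries from central classes multiplies the central characters. -/
theorem Center.fusion {g : M.Lat} {p q r : I} (hp : (g.cls p).IsCentral)
    (hq : (g.cls q).IsCentral) (hN : 0 < M.N p q r) :
    ∃ hr : (g.cls r).IsCentral, ∀ α : g,
      (Center.of r hr).char α = (Center.of p hp).char α * (Center.of q hq).char α := by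
  have h : ∀ α : g, M.rho r α
      = (Center.of p hp).char α * (Center.of q hq).char α * (M.qdim α : ℂ) := fun α =>
    M.rho_fusion (Center.norm_char _ α) (Center.norm_char _ α) (Center.rho_eq hp α)
      (Center.rho_eq hq α) hN
  refine ⟨isCentral_iff.2 fun α hα => ?_, fun α => ?_⟩
  · rw [h ⟨α, hα⟩, norm_mul, norm_mul, Center.norm_char, Center.norm_char, Complex.norm_real,
      Real.norm_of_nonneg (M.qdim_pos _).le, one_mul, one_mul]
  · have h0 : (M.qdim α : ℂ) ≠ 0 := by exact_mod_cast (M.qdim_pos α).ne'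
    rw [Center.char_mk, h α, mul_div_cancel_right₀ _ h0]

theorem Center.exists_mul {g : M.Lat} (z w : g.Center) :
    ∃ x : g.Center, ∀ α, x.char α = z.char α * w.char α := by
  induction z using Center.ind with
  | h p hp =>
    induction w using Center.ind with
    | h q hq =>
      obtain ⟨r, hr⟩ := M.exists_fusion p q
      obtain ⟨hc, h⟩ := Center.fusion hp hq hr
      exact ⟨_, h⟩

theorem Center.exists_inv {g : M.Lat} (z : g.Center) :
    ∃ x : g.Center, ∀ α, x.char α * z.char α = 1 := by
  induction z using Center.ind with
  | h p hp =>
    obtain ⟨q, hq⟩ : ∃ q, 0 < M.N p q M.vac := by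
      by_contra! hcon
      have h := M.qdim_conj_sum p M.vac
      have h0 : ∀ r, M.N p r M.vac = 0 := fun r => Nat.le_zero.1 (hcon r)
      simp only [h0, Nat.cast_zero, zero_mul, Finset.sum_const_zero] at h
      exact (mul_pos (M.qdim_pos p) (M.qdim_pos _)).ne h
    have h : ∀ α : g, M.rho q α = conj ((Center.of p hp).char α) * (M.qdim α : ℂ) := fun α =>
      M.rho_conjugate (Center.norm_char _ α) (Center.rho_eq hp α) hq
    have hc : (g.cls q).IsCentral := isCentral_iff.2 fun α hα => by
      rw [h ⟨α, hα⟩, norm_mul, RCLike.norm_conj, Center.norm_char, Complex.norm_real,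
        Real.norm_of_nonneg (M.qdim_pos _).le, one_mul]
    refine ⟨Center.of q hc, fun α => ?_⟩
    have h0 : (M.qdim α : ℂ) ≠ 0 := by exact_mod_cast (M.qdim_pos α).ne'
    rw [Center.char_mk q hc, h α, mul_div_cancel_right₀ _ h0, mul_comm, Complex.mul_conj,
      Complex.normSq_eq_norm_sq, Center.norm_char]
    simp

theorem isCentral_vac (g : M.Lat) : (g.cls M.vac).IsCentral :=
  isCentral_iff.2 fun α _ => by
    rw [M.rho_vac_left, Complex.norm_real, Real.norm_of_nonneg (M.qdim_pos α).le]

/-- The product of central classes is the central class whose central character is the product of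
their central characters. -/
noncomputable instance (g : M.Lat) : Mul g.Center := ⟨fun z w => (Center.exists_mul z w).choose⟩

/-- The identity of the center is the trivial class. -/
instance (g : M.Lat) : One g.Center := ⟨Center.of M.vac (isCentral_vac g)⟩

noncomputable instance (g : M.Lat) : Inv g.Center := ⟨fun z => (Center.exists_inv z).choose⟩

theorem Center.char_mul {g : M.Lat} (z w : g.Center) (α : g) :
    (z * w).char α = z.char α * w.char α := (Center.exists_mul z w).choose_spec α

theorem Center.char_one {g : M.Lat} (α : g) : (1 : g.Center).char α = 1 := by
  have h0 : (M.qdim α : ℂ) ≠ 0 := by exact_mod_cast (M.qdim_pos α).ne'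
  change M.rho M.vac α / (M.qdim α : ℂ) = 1
  rw [M.rho_vac_left, div_self h0]

theorem Center.char_inv_mul {g : M.Lat} (z : g.Center) (α : g) :
    z⁻¹.char α * z.char α = 1 := (Center.exists_inv z).choose_spec α

/-- The center is an abelian group. -/
noncomputable instance (g : M.Lat) : CommGroup g.Center where
  mul_assoc a b c := Center.char_injective <| funext fun α => by
    simp only [Center.char_mul, mul_assoc]
  one_mul a := Center.char_injective <| funext fun α => by
    simp only [Center.char_mul, Center.char_one, one_mul]
  mul_one a := Center.char_injective <| funext fun α => by
    simp only [Center.char_mul, Center.char_one, mul_one]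
  inv_mul_cancel a := Center.char_injective <| funext fun α => by
    simp only [Center.char_mul, Center.char_one, Center.char_inv_mul]
  mul_comm a b := Center.char_injective <| funext fun α => by
    simp only [Center.char_mul, mul_comm]

/-! ### Central quotients -/

/-- The union of the central classes belonging to a subgroup of the center. -/
def unionOf {g : M.Lat} (H : Subgroup g.Center) : Set I := {p | ∃ z ∈ H, p ∈ z.toCls.toSet}

/-- The central quotient `g / H`: the element of the lattice whose trivial class is the union of the
central classes in `H`; see `coe_dual_centralQuotient` and `dual_dual`. -/
def centralQuotient (g : M.Lat) (H : Subgroup g.Center) : M.Lat := perpSet M (unionOf H)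

/-- The maximal central quotient `∂g = g / Z(g)`. -/
noncomputable def maxCentralQuotient (g : M.Lat) : M.Lat := g.centralQuotient ⊤

theorem le_dual_dual (g : M.Lat) {α : I} (hα : α ∈ g) : α ∈ g.dual.dual := by
  intro p hp
  have hp' : M.rho p α = M.rho M.vac α := hp α hα
  have h0 : (M.qdim α : ℂ) ≠ 0 := by exact_mod_cast (M.qdim_pos α).ne'
  have h := M.rho_symm p α
  rw [hp', M.rho_vac_left] at h
  rw [M.rho_vac_left]
  apply mul_right_cancel₀ h0
  rw [← h]; ring

/-- The duality map is involutive. -/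
theorem dual_dual (g : M.Lat) : g.dual.dual = g := by
  classical
  have hm : ∀ g : M.Lat, (∑ p with p ∈ g.dual, M.qdim p ^ 2) * ∑ α with α ∈ g, M.qdim α ^ 2
      = ((M.S M.vac M.vac).re ^ 2)⁻¹ := by
    intro g
    have h := mass_mul g M.vac
    have hv : ∀ α, ‖M.rho M.vac α‖ ^ 2 = M.qdim α ^ 2 := fun α => by
      rw [M.rho_vac_left, Complex.norm_real, Real.norm_of_nonneg (M.qdim_pos α).le]
    simp_rw [hv] at h
    rw [← h]
    congr 1
    unfold Cls.mass
    refine Finset.sum_congr (Finset.filter_congr fun p _ => ?_) fun _ _ => rfl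
    rw [← coe_dual]; rfl
  have hpos : 0 < ∑ p with p ∈ g.dual, M.qdim p ^ 2 :=
    Finset.sum_pos (fun p _ => pow_pos (M.qdim_pos p) 2)
      ⟨M.vac, Finset.mem_filter.2 ⟨Finset.mem_univ _, g.dual.vac_mem⟩⟩
  have heq : ∑ α with α ∈ g.dual.dual, M.qdim α ^ 2 = ∑ α with α ∈ g, M.qdim α ^ 2 := by
    apply mul_right_cancel₀ hpos.ne'
    rw [hm g.dual, ← hm g, mul_comm]
  refine SetLike.ext fun β => ⟨fun hβ => ?_, fun hβ => le_dual_dual g hβ⟩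
  by_contra hcon
  have hlt : ∑ α with α ∈ g, M.qdim α ^ 2 < ∑ α with α ∈ g.dual.dual, M.qdim α ^ 2 :=
    Finset.sum_lt_sum_of_subset
      (fun α hα => Finset.mem_filter.2 ⟨Finset.mem_univ _,
        le_dual_dual g (Finset.mem_filter.1 hα).2⟩)
      (Finset.mem_filter.2 ⟨Finset.mem_univ _, hβ⟩)
      (fun h => hcon (Finset.mem_filter.1 h).2) (pow_pos (M.qdim_pos β) 2)
      (fun x _ _ => (pow_pos (M.qdim_pos x) 2).le)
  exact hlt.ne' heq

/-- The trivial class of the central quotient `g / H` is the union of the classes in `H`. -/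
theorem coe_dual_centralQuotient (g : M.Lat) (H : Subgroup g.Center) :
    ((g.centralQuotient H).dual : Set I) = unionOf H := by
  let k : M.Lat :=
    { carrier := unionOf H
      vac_mem := ⟨1, H.one_mem, rfl⟩
      fusion_mem := by
        rintro p q r ⟨z, hz, hpz⟩ ⟨w, hw, hqw⟩ hN
        have hpz' : g.cls p = z.toCls := hpz
        have hqw' : g.cls q = w.toCls := hqw
        have hp : (g.cls p).IsCentral := hpz' ▸ z.isCentral
        have hq : (g.cls q).IsCentral := hqw' ▸ w.isCentral
        have hz' : Center.of p hp ∈ H := by rwa [show Center.of p hp = z from Center.ext hpz']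
        have hw' : Center.of q hq ∈ H := by rwa [show Center.of q hq = w from Center.ext hqw']
        obtain ⟨hr, h⟩ := Center.fusion hp hq hN
        refine ⟨Center.of r hr, ?_, rfl⟩
        have : Center.of r hr = Center.of p hp * Center.of q hq :=
          Center.char_injective (funext fun α => by rw [h, Center.char_mul])
        rw [this]
        exact H.mul_mem hz' hw' }
  have h : g.centralQuotient H = k.dual := rfl
  rw [h, dual_dual]
  rfl

/-! ### The restriction homomorphism -/

theorem Center.isCentral_of_le {g h : M.Lat} (hle : h ≤ g) {p : I} (hp : (g.cls p).IsCentral) :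
    (h.cls p).IsCentral :=
  isCentral_iff.2 fun α hα => isCentral_iff.1 hp α (hle α hα)

/-- For `h ≤ g`, the `h`-class that contains a given `g`-class. -/
def Cls.restrict {g h : M.Lat} (hle : h ≤ g) (C : g.Cls) : h.Cls :=
  Quotient.map (sa := g.classSetoid) (sb := h.classSetoid) id
    (fun _ _ hpq α hα => hpq α (hle α hα)) C

theorem Cls.toSet_subset_restrict {g h : M.Lat} (hle : h ≤ g) (C : g.Cls) :
    C.toSet ⊆ (C.restrict hle).toSet := by
  rintro p rfl
  rfl

/-- The central `h`-class that contains a given central `g`-class. -/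
def Center.restrict {g h : M.Lat} (hle : h ≤ g) (z : g.Center) : h.Center where
  toCls := z.toCls.restrict hle
  isCentral := by
    induction z using Center.ind with
    | h p hp => exact Center.isCentral_of_le hle hp

theorem Center.char_restrict {g h : M.Lat} (hle : h ≤ g) (z : g.Center) (α : h) :
    (z.restrict hle).char α = z.char ⟨α, hle α α.2⟩ := by
  induction z using Center.ind with
  | h p hp => rfl

/-- The restriction homomorphism `Z(g) → Z(h)` for `h ≤ g`, that assigns to each central `g`-class
the `h`-class that contains it. -/
noncomputable def res {g h : M.Lat} (hle : h ≤ g) : g.Center →* h.Center where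
  toFun z := z.restrict hle
  map_one' := rfl
  map_mul' z w := Center.char_injective <| funext fun α => by
    simp only [Center.char_mul, Center.char_restrict]

/-- `Z(g|h)`: the kernel of the restriction homomorphism. -/
noncomputable def resKer {g h : M.Lat} (hle : h ≤ g) : Subgroup g.Center := (res hle).ker

/-- `I(g|h)`: the image of the restriction homomorphism. -/
noncomputable def resIm {g h : M.Lat} (hle : h ≤ g) : Subgroup h.Center := (res hle).range

end Lat

end ConformalModel

namespace ConformalModel

/-! Everything is read off after applying `𝔤 ↦ 𝔤^⊥`, an inclusion-reversing involution, which
therefore exchanges joins and meets (`dual_sup`, `dual_inf`). The trivial class of a central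
quotient `𝔤/H` is the union of the classes in `H`; in particular `(∂𝔤)^⊥` consists of all primaries
lying in central `𝔤`-classes.

A central `𝔤`-class lies in the kernel of restriction exactly when it is contained in `𝔥^⊥`. So the
dual of `𝔤/Z(𝔤|𝔥)` is `𝔥^⊥ ∩ (∂𝔤)^⊥`, which is the dual of `𝔥 ∨ ∂𝔤`.

The dual of `𝔥/I(𝔤|𝔥)` is the union of the `𝔥`-classes that meet `(∂𝔤)^⊥`. It clearly contains `𝔥^⊥`
and `(∂𝔤)^⊥`. The substantial point is that it is no larger than their join, and this is
`mem_of_cls_eq`: a lattice element containing `𝔥^⊥` and one member of a central `𝔥`-class contains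
the whole class, which behaves like a coset of `𝔥^⊥`.

For the last identity, a central `𝔥`-class restricts trivially to `𝔥 ∩ ∂𝔤` exactly when it lies in
`(𝔥 ∩ ∂𝔤)^⊥ = (𝔥/I(𝔤|𝔥))^⊥`, that is, when it belongs to `I(𝔤|𝔥)`. -/

theorem exists_fusion_vac {I : Type*} [Fintype I] [DecidableEq I] (M : ConformalModel I) (p : I) :
    ∃ q, 0 < M.N p q M.vac := by
  by_contra! hcon
  -- The sum of `N p q 0 · d_q` over `q` equals `d_p · d_0 > 0`, so its terms cannot all vanish.
  have h := M.qdim_conj_sum p M.vac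
  have h0 : ∀ r, M.N p r M.vac = 0 := fun r => Nat.le_zero.1 (hcon r)
  simp only [h0, Nat.cast_zero, zero_mul, Finset.sum_const_zero] at h
  exact (mul_pos (M.qdim_pos p) (M.qdim_pos _)).ne h

namespace Lat

variable {I : Type*} [Fintype I] [DecidableEq I] {M : ConformalModel I}

/-! ### Duality as an anti-automorphism of the lattice. -/

theorem mem_dual_iff {g : M.Lat} {p : I} : p ∈ g.dual ↔ g.cls p = g.cls M.vac :=
  (cls_eq_iff (g := g) (p := p) (q := M.vac)).symm

theorem dual_anti {g h : M.Lat} (hle : h ≤ g) : g.dual ≤ h.dual :=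
  fun _ hp α hα => hp α (hle α hα)

theorem le_dual_comm {g h : M.Lat} : g ≤ h.dual ↔ h ≤ g.dual :=
  ⟨fun H => by simpa only [dual_dual] using dual_anti H,
    fun H => by simpa only [dual_dual] using dual_anti H⟩

theorem dual_injective : Function.Injective (dual (M := M)) := fun g h H => by
  rw [← dual_dual g, H, dual_dual]

/-- Purely order-theoretic: the symmetry `le_dual_comm` moves the nontrivial inclusion to the
universal property of the join, so no description of the join's elements is needed. -/
theorem dual_sup (g h : M.Lat) : (g ⊔ h).dual = g.dual ⊓ h.dual := by
  refine le_antisymm (le_inf (dual_anti le_sup_left) (dual_anti le_sup_right)) ?_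
  exact le_dual_comm.1 (sup_le (le_dual_comm.1 inf_le_left) (le_dual_comm.1 inf_le_right))

theorem dual_inf (g h : M.Lat) : (g ⊓ h).dual = g.dual ⊔ h.dual :=
  dual_injective <| by rw [dual_sup, dual_dual, dual_dual, dual_dual]

/-! ### Trivial classes of central quotients; kernel and image of restriction in terms of primaries.
-/

theorem mem_dual_centralQuotient {g : M.Lat} {H : Subgroup g.Center} {p : I} :
    p ∈ (g.centralQuotient H).dual ↔ ∃ hp : (g.cls p).IsCentral, Center.of p hp ∈ H := by
  rw [← SetLike.mem_coe, coe_dual_centralQuotient]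
  constructor
  · rintro ⟨z, hz, hp⟩
    have hp' : g.cls p = z.toCls := hp
    refine ⟨hp' ▸ z.isCentral, ?_⟩
    rwa [show Center.of p _ = z from Center.ext hp']
  · rintro ⟨hp, hH⟩
    exact ⟨_, hH, rfl⟩

theorem mem_dual_maxCentralQuotient {g : M.Lat} {p : I} :
    p ∈ g.maxCentralQuotient.dual ↔ (g.cls p).IsCentral :=
  mem_dual_centralQuotient.trans (by simp)

theorem of_mem_resKer_iff {g h : M.Lat} (hle : h ≤ g) {p : I} (hp : (g.cls p).IsCentral) :
    Center.of p hp ∈ resKer hle ↔ p ∈ h.dual := by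
  rw [mem_dual_iff]
  -- By definition, the restricted class is `h.cls p` and the identity of the center is `h.cls
  -- M.vac`.
  exact ⟨fun H => congrArg Center.toCls H, fun H => Center.ext H⟩

theorem of_mem_resIm_iff {g h : M.Lat} (hle : h ≤ g) {p : I} (hp : (h.cls p).IsCentral) :
    Center.of p hp ∈ resIm hle ↔ ∃ q, (g.cls q).IsCentral ∧ h.cls q = h.cls p := by
  constructor
  · rintro ⟨z, hz⟩
    induction z using Center.ind with
    | h q hq => exact ⟨q, hq, congrArg Center.toCls hz⟩
  · rintro ⟨q, hq, hqp⟩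
    exact ⟨Center.of q hq, Center.ext hqp⟩

/-- An element of the lattice containing the trivial `h`-class contains the `h`-class of each of its
members that lies in a central class. -/
theorem mem_of_cls_eq {h k : M.Lat} (hk : h.dual ≤ k) {p q : I} (hq : q ∈ k)
    (hc : (h.cls q).IsCentral) (hqp : h.cls q = h.cls p) : p ∈ k := by
  -- Here `s` plays the charge conjugate of `q`, and `r` the quotient of `p` by `q`. It suffices
  -- that `r` lies in the trivial `h`-class: then `s, r ∈ k`, and `p` is recovered as a fusion
  -- quotient.
  obtain ⟨s, hs⟩ := M.exists_fusion_vac q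
  obtain ⟨r, hr⟩ := M.exists_fusion s p
  have hsk : s ∈ k := k.quot_mem hq k.vac_mem hs
  refine k.quot_mem hsk (hk r fun α hα => ?_) hr
  have hu := Center.norm_char (Center.of q hc) ⟨α, hα⟩
  have hqα := Center.rho_eq hc ⟨α, hα⟩
  have hpα : M.rho p α = _ := (cls_eq_iff.1 hqp α hα).symm.trans hqα
  -- If `q`, hence also `p`, acts on `α` by `u · d_α` with `|u| = 1`, then `s` acts by `conj u ·
  -- d_α`, and `r` by `conj u · u · d_α = d_α`, as the vacuum does.
  rw [M.rho_fusion (by rw [RCLike.norm_conj, hu]) hu (M.rho_conjugate hu hqα hs) hpα hr,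
    M.rho_vac_left, mul_comm (conj _), Complex.mul_conj, Complex.normSq_eq_norm_sq, hu]
  simp

/-! ### The three identities. -/

theorem centralQuotient_resKer {g h : M.Lat} (hle : h ≤ g) :
    g.centralQuotient (resKer hle) = h ⊔ g.maxCentralQuotient := by
  refine dual_injective (SetLike.ext fun p => ?_)
  rw [dual_sup, mem_dual_centralQuotient]
  change _ ↔ p ∈ h.dual ∧ p ∈ g.maxCentralQuotient.dual
  rw [mem_dual_maxCentralQuotient]
  simp only [of_mem_resKer_iff, exists_prop, and_comm]

theorem centralQuotient_resIm {g h : M.Lat} (hle : h ≤ g) :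
    h.centralQuotient (resIm hle) = h ⊓ g.maxCentralQuotient := by
  refine dual_injective ?_
  rw [dual_inf]
  refine le_antisymm (fun p hp => ?_) (sup_le (fun p hp => ?_) fun p hp => ?_)
  -- The `h`-class of `p` contains some `q` whose `g`-class is central; `q` lies in the join, and
  -- the class of `q` follows it there.
  · obtain ⟨hc, hI⟩ := mem_dual_centralQuotient.1 hp
    obtain ⟨q, hq, hqp⟩ := (of_mem_resIm_iff hle hc).1 hI
    exact mem_of_cls_eq le_sup_left
      ((le_sup_right : g.maxCentralQuotient.dual ≤ h.dual ⊔ _) q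
        (mem_dual_maxCentralQuotient.2 hq)) (Center.isCentral_of_le hle hq) hqp
  · have hp' := mem_dual_iff.1 hp
    refine mem_dual_centralQuotient.2 ⟨hp' ▸ isCentral_vac h, ?_⟩
    -- The trivial `h`-class is the restriction of the trivial `g`-class, so the vacuum is the
    -- witness.
    exact (of_mem_resIm_iff hle _).2 ⟨M.vac, isCentral_vac g, hp'.symm⟩
  · have hp' := mem_dual_maxCentralQuotient.1 hp
    exact mem_dual_centralQuotient.2
      ⟨Center.isCentral_of_le hle hp', (of_mem_resIm_iff hle _).2 ⟨p, hp', rfl⟩⟩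

theorem resIm_eq_resKer {g h : M.Lat} (hle : h ≤ g) :
    resIm hle = resKer (inf_le_left : h ⊓ g.maxCentralQuotient ≤ h) := by
  ext z
  induction z using Center.ind with
  | h p hp =>
    -- The second identity, read backwards, turns the dual of the meet into the union of the classes
    -- in the image.
    rw [of_mem_resKer_iff, ← centralQuotient_resIm hle, mem_dual_centralQuotient]
    exact ⟨fun H => ⟨hp, H⟩, fun ⟨_, H⟩ => H⟩

end Lat

end ConformalModel

theorem mainTheorem4 {I : Type*} [Fintype I] [DecidableEq I] (M : ConformalModel I)
    (g h : M.Lat) (hle : h ≤ g) :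
    g.centralQuotient (ConformalModel.Lat.resKer hle) = h ⊔ g.maxCentralQuotient ∧
    h.centralQuotient (ConformalModel.Lat.resIm hle) = h ⊓ g.maxCentralQuotient ∧
    ConformalModel.Lat.resIm hle =
      ConformalModel.Lat.resKer (inf_le_left : h ⊓ g.maxCentralQuotient ≤ h) :=
  ⟨ConformalModel.Lat.centralQuotient_resKer hle, ConformalModel.Lat.centralQuotient_resIm hle,
    ConformalModel.Lat.resIm_eq_resKer hle⟩
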